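/- **Definitions (spaces).** Let $X$ be a topological space. Write $x\le y$ if every open set containing $x$ contains $y$. For $U\subseteq X$ put ${\downarrow}U=\{x\mid \exists y\in U,\ x\le y\}$, $\mathrm{Int}_{\le}U=\{x\mid \forall y\ge x,\ y\in U\}$ and $U^{\bot}=X\setminus\overline U$. Call $U$ *regular open* if $U^{\bot\bot}=U$, *regular closed* if $X\setminus U$ is regular open, and *order-regular open* if $\mathrm{Int}_{\le}({\downarrow}U)=U$. Let $\mathsf{RO}(X)$ be the Boolean algebra of regular open sets, and for $U,V\subseteq X$ write $U\ll V$ if $\overline U\subseteq{\downarrow}V$. A *filter* on $\mathsf{RO}(X)$ is a subset of $\mathsf{RO}(X)$ that contains $X$, does not contain $\emptyset$, is closed under binary intersections, and is upward closed in $\mathsf{RO}(X)$. For a filter $F$ put $F^{\circ}=\{U\in F\mid \exists W\in F,\ W\ll U\}$, and call $F$ *concordant* if $F^{\circ}=F$. For $x\in X$ put $\mathsf{RO}(x)=\{U\in\mathsf{RO}(X)\mid x\in U\}$. The space $X$ is a *$dV$-space* if: 1. $X$ is $T_0$, compact and order-normal, i.e. for every closed $A$ and every regular closed $B$ with $A\cap\mathrm{Int}_{\le}B=\emptyset$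 there are disjoint open sets $U,V$ with $A\subseteq{\downarrow}U$ and $\mathrm{Int}_{\le}B\subseteq V$; 2. $\mathsf{RO}(X)$ is a basis of the topology, and every regular open set is order-regular open; 3. $\mathsf{RO}(x)$ is a concordant filter for every $x\in X$, and for every filter $F$ on $\mathsf{RO}(X)$ there is $x\in X$ with $F^{\circ}=\mathsf{RO}(x)$. **Definitions (calculus).** Formulas are built from countably many propositional letters and $\bot$ by $\neg$, $\wedge$ and a binary connective $\rightsquigarrow$; the connectives $\top,\vee,\to,\leftrightarrow$ are the usual classical abbreviations, and $\Box\varphi$ abbreviates $\top\rightsquigarrow\varphi$. The Symmetric Strict Implication Calculus $\mathsf{S^2IC}$ has as axioms all substitution instances of classical tautologies and all formulas of the forms - $(\bot\rightsquigarrow\varphi)\wedge(\varphi\rightsquigarrow\top)$; - $((\varphi\vee\psi)\rightsquigarrow\chi)\leftrightarrow((\varphi\rightsquigarrow\chi)\wedge(\psi\rightsquigarrow\chi))$; - $(\varphi\rightsquigarrow(\psi\wedge\chi))\leftrightarrow((\varphi\rightsquigarrow\psi)\wedge(\varphi\rightsquigarrow\chi))$; - $(\varphi\rightsquigarrow\psi)\to(\varphi\to\psi)$;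 - $(\varphi\rightsquigarrow\psi)\leftrightarrow(\neg\psi\rightsquigarrow\neg\varphi)$; - $\Box\varphi\to\Box\Box\varphi$; - $\neg\Box\varphi\to\Box\neg\Box\varphi$; - $(\varphi\rightsquigarrow\psi)\leftrightarrow\Box(\varphi\rightsquigarrow\psi)$; - $\Box\varphi\to(\neg\Box\varphi\rightsquigarrow\bot)$; and as rules modus ponens, necessitation (from $\varphi$ infer $\Box\varphi$), and replacement of equivalents under $\rightsquigarrow$ (from $\varphi\leftrightarrow\varphi'$ and $\psi\leftrightarrow\psi'$ infer $(\varphi\rightsquigarrow\psi)\leftrightarrow(\varphi'\rightsquigarrow\psi')$). **Definitions (semantics).** A *de Vries topological model* is a $dV$-space $X$ with a map $V$ from formulas to subsets of $X$ such that $V(p)\in\mathsf{RO}(X)$ for every letter $p$, $V(\bot)=\emptyset$, $V(\neg\varphi)=V(\varphi)^{\bot}$, $V(\varphi\wedge\psi)=V(\varphi)\cap V(\psi)$, and $V(\varphi\rightsquigarrow\psi)=X$ if $\overline{V(\varphi)}\subseteq{\downarrow}V(\psi)$, while $V(\varphi\rightsquigarrow\psi)=\emptyset$ otherwise. A formula $\varphi$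 is *valid* on a $dV$-space $X$ if $V(\varphi)=X$ for every de Vries topological model $(X,V)$ on $X$. **Theorem.** $\mathsf{S^2IC}$ is sound and complete with respect to the class of all $dV$-spaces: a formula $\varphi$ is a theorem of $\mathsf{S^2IC}$ if and only if $\varphi$ is valid on every $dV$-space. -/

import Mathlib

universe u

namespace DeVries

/-! ### Order and regular opens in a topological space -/

section Space

variable {X : Type u} [TopologicalSpace X]

/-- The specialization preorder: `x ≤ y` iff every open set containing `x` contains `y`.
(Mathlib's `y ⤳ x` says that `x` lies in the closure of `{y}`, which is the same thing.) -/
def SpecLE (x y : X) : Prop := ∀ U : Set X, IsOpen U → x ∈ U → y ∈ U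

/-- `↓ U`: the closure of `U` in the topology of up-sets of the specialization preorder. -/
def down (U : Set X) : Set X := {x | ∃ y ∈ U, SpecLE x y}

/-- The interior of `U` in the topology of up-sets of the specialization preorder. -/
def upInterior (U : Set X) : Set X := {x | ∀ y, SpecLE x y → y ∈ U}

/-- `U^⊥`: the complement of the closure of `U`. -/
def perp (U : Set X) : Set X := (closure U)ᶜ

/-- Regular open sets, `U^⊥⊥ = U`. -/
def IsRegularOpen (U : Set X) : Prop := perp (perp U) = U

/-- Regular closed sets: complements of regular open sets. -/
def IsRegularClosed (B : Set X) : Prop := IsRegularOpen Bᶜ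

/-- Order-regular open sets: the regular open sets of the up-set topology. -/
def IsOrderRegularOpen (U : Set X) : Prop := upInterior (down U) = U

/-- `U ≪ V` iff the closure of `U` is contained in `↓ V`. -/
def WayBelow (U V : Set X) : Prop := closure U ⊆ down V

variable (X) in
/-- Order-normality. -/
def IsOrderNormal : Prop :=
  ∀ A B : Set X, IsClosed A → IsRegularClosed B → Disjoint A (upInterior B) →
    ∃ U V : Set X, IsOpen U ∧ IsOpen V ∧ Disjoint U V ∧ A ⊆ down U ∧ upInterior B ⊆ V

/-- Proper filters on the Boolean algebra `RO(X)` of regular open sets (whose order is inclusion,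
whose binary meet is intersection, and whose bounds are `∅` and `X`). -/
structure IsROFilter (F : Set (Set X)) : Prop where
  regular : ∀ U ∈ F, IsRegularOpen U
  univ_mem : Set.univ ∈ F
  empty_notMem : ∅ ∉ F
  mem_of_subset : ∀ U V : Set X, U ∈ F → IsRegularOpen V → U ⊆ V → V ∈ F
  inter_mem : ∀ U V : Set X, U ∈ F → V ∈ F → U ∩ V ∈ F

/-- The members of `F` that some member of `F` is `≪`-below. -/
def roundPart (F : Set (Set X)) : Set (Set X) := {U | U ∈ F ∧ ∃ W ∈ F, WayBelow W U}

/-- Concordant filters on `(RO(X), ≪)`. -/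
def IsConcordant (F : Set (Set X)) : Prop := IsROFilter F ∧ roundPart F = F

/-- `RO(x)`: the regular open sets containing `x`. -/
def roNhds (x : X) : Set (Set X) := {U | IsRegularOpen U ∧ x ∈ U}

variable (X) in
/-- De Vries spaces (`dV`-spaces). -/
structure IsDVSpace : Prop where
  t0 : T0Space X
  compact : CompactSpace X
  orderNormal : IsOrderNormal X
  basis : TopologicalSpace.IsTopologicalBasis {U : Set X | IsRegularOpen U}
  orderRegular : ∀ U : Set X, IsRegularOpen U → IsOrderRegularOpen U
  concordant : ∀ x : X, IsConcordant (roNhds x)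
  realized : ∀ F : Set (Set X), IsROFilter F → ∃ x : X, roundPart F = roNhds x

end Space

/-! ### The calculus -/

/-- Formulas: classical propositional formulas over countably many letters, with an additional
binary connective `strict φ ψ`, the strict implication `φ ⇝ ψ`. -/
inductive Formula : Type
  | letter : ℕ → Formula
  | bot : Formula
  | neg : Formula → Formula
  | and : Formula → Formula → Formula
  | strict : Formula → Formula → Formula

namespace Formula

/-- `⊤` -/
def top : Formula := neg bot

/-- `φ ∨ ψ` -/
def or (φ ψ : Formula) : Formula := neg (and (neg φ) (neg ψ))

/-- `φ → ψ` -/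
def imp (φ ψ : Formula) : Formula := neg (and φ (neg ψ))

/-- `φ ↔ ψ` -/
def iff (φ ψ : Formula) : Formula := and (imp φ ψ) (imp ψ φ)

/-- `□ φ`, that is `⊤ ⇝ φ`. -/
def box (φ : Formula) : Formula := strict top φ

/-- Substitution instances of classical propositional tautologies: the formulas true under every
classical truth assignment, letters and formulas `φ ⇝ ψ` being treated as atoms. -/
def IsTautology (φ : Formula) : Prop :=
  ∀ v : Formula → Prop, ¬ v bot → (∀ α, v (neg α) ↔ ¬ v α) →
    (∀ α β, v (and α β) ↔ v α ∧ v β) → v φ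

end Formula

open Formula in
/-- Theorems of the Symmetric Strict Implication Calculus `S²IC`. -/
inductive S2IC : Formula → Prop
  | taut (φ : Formula) : IsTautology φ → S2IC φ
  | bounds (φ : Formula) : S2IC (and (strict bot φ) (strict φ top))
  | or_left (φ ψ χ : Formula) :
      S2IC (iff (strict (or φ ψ) χ) (and (strict φ χ) (strict ψ χ)))
  | and_right (φ ψ χ : Formula) :
      S2IC (iff (strict φ (and ψ χ)) (and (strict φ ψ) (strict φ χ)))
  | strict_imp (φ ψ : Formula) : S2IC (imp (strict φ ψ) (imp φ ψ))
  | symmetry (φ ψ : Formula) : S2IC (iff (strict φ ψ) (strict (neg ψ) (neg φ)))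
  | four (φ : Formula) : S2IC (imp (box φ) (box (box φ)))
  | five (φ : Formula) : S2IC (imp (neg (box φ)) (box (neg (box φ))))
  | strict_box (φ ψ : Formula) : S2IC (iff (strict φ ψ) (box (strict φ ψ)))
  | box_bot (φ : Formula) : S2IC (imp (box φ) (strict (neg (box φ)) bot))
  | modus_ponens (φ ψ : Formula) : S2IC (imp φ ψ) → S2IC φ → S2IC ψ
  | necessitation (φ : Formula) : S2IC φ → S2IC (box φ)
  | congruence (φ φ' ψ ψ' : Formula) : S2IC (iff φ φ') → S2IC (iff ψ ψ') →
      S2IC (iff (strict φ ψ) (strict φ' ψ'))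

/-! ### Topological semantics -/

open Classical in
/-- The value of a formula under the valuation that extends `V`. -/
noncomputable def Formula.eval {X : Type u} [TopologicalSpace X] (V : ℕ → Set X) :
    Formula → Set X
  | letter p => V p
  | bot => ∅
  | neg φ => perp (eval V φ)
  | and φ ψ => eval V φ ∩ eval V ψ
  | strict φ ψ => if closure (eval V φ) ⊆ down (eval V ψ) then Set.univ else ∅

/-- `φ` is valid on `X`: its value is all of `X` for every assignment of regular open sets to the
letters, that is, in every de Vries topological model on `X`. -/
def Valid (X : Type u) [TopologicalSpace X] (φ : Formula) : Prop :=
  ∀ V : ℕ → Set X, (∀ p, IsRegularOpen (V p)) → Formula.eval V φ = Set.univ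

end DeVries

/-! Soundness uses only one clause of a `dV`-space: regular open sets are order-regular open. This
makes `≪` invariant under contraposition (`wayBelow_perp_perp_iff`), which turns the law for
conjunctions on the right into the law for unions of closures. A formula `φ ⇝ ψ` has value `∅` or
the whole space, which settles the modal axioms. Tautologies are handled by ultrafilters containing
all dense open sets, since these read values as classical truth assignments.

For completeness, a maximal consistent `Γ` omitting `φ` is turned into a compact Hausdorff space.
Its points are pairs of valuations in contact, joined by a segment: left of `0` the first valuation
decides a formula, right of `0` the second one does. At `0` the open set `truth` demands both, while
its closure demands only one. Hence `closure (truth Γ φ) ⊆ truth Γ ψ` says exactly that contact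
carries `φ` to `ψ`, and by `exists_witness` this amounts to `Γ (φ ⇝ ψ)`
(`closure_truth_subset_iff`). The segments supply the interpolation needed for `≪`, on which the
calculus has no axiom.

It remains to pass from a compact Hausdorff `Z` to a `dV`-space. The nonempty closed subsets of `Z`
with the upper Vietoris topology form one (`isDVSpace`). Its regular open sets are the `inside U`
with `U` regular open in `Z`, and `≪` becomes `closure U ⊆ V` (`wayBelow_inside`), so models on `Z`
transfer (`eval_eq_inside`). -/

namespace DeVries

open Set Topology

/-! ### Soundness -/

section Soundness

theorem inter_eq_univ_iff {Y : Type*} {S T : Set Y} : S ∩ T = univ ↔ S = univ ∧ T = univ := by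
  simp only [← univ_subset_iff, subset_inter_iff]

variable {X : Type u} [TopologicalSpace X]

theorem SpecLE.refl (x : X) : SpecLE x x := fun _ _ h => h

theorem subset_down (U : Set X) : U ⊆ down U := fun x hx => ⟨x, hx, SpecLE.refl x⟩

theorem down_empty : down (∅ : Set X) = ∅ := by
  ext x; simp [down]

theorem isOpen_perp (U : Set X) : IsOpen (perp U) := isClosed_closure.isOpen_compl

theorem IsRegularOpen.isOpen {U : Set X} (h : IsRegularOpen U) : IsOpen U := h ▸ isOpen_perp _

theorem perp_eq_interior_compl (U : Set X) : perp U = interior Uᶜ := by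
  simp [perp]

theorem perp_anti {U V : Set X} (h : U ⊆ V) : perp V ⊆ perp U :=
  compl_subset_compl.2 (closure_mono h)

theorem subset_perp_perp {U : Set X} (h : IsOpen U) : U ⊆ perp (perp U) := by
  rw [perp_eq_interior_compl (perp U), perp, compl_compl]
  exact h.subset_interior_iff.2 subset_closure

theorem isRegularOpen_perp {U : Set X} (hU : IsOpen U) : IsRegularOpen (perp U) :=
  Subset.antisymm (perp_anti (subset_perp_perp hU)) (subset_perp_perp (isOpen_perp U))

theorem closure_perp_of_regular {U : Set X} (h : IsRegularOpen U) : closure (perp U) = Uᶜ := by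
  rw [← compl_compl (closure (perp U))]
  exact congrArg compl h

theorem IsRegularOpen.inter {U V : Set X} (hU : IsRegularOpen U) (hV : IsRegularOpen V) :
    IsRegularOpen (U ∩ V) := by
  refine Subset.antisymm ?_ (subset_perp_perp (hU.isOpen.inter hV.isOpen))
  refine subset_inter ?_ ?_
  · exact (perp_anti (perp_anti inter_subset_left)).trans hU.subset
  · exact (perp_anti (perp_anti inter_subset_right)).trans hV.subset

theorem isRegularOpen_empty : IsRegularOpen (∅ : Set X) := by
  simp [IsRegularOpen, perp]

theorem isRegularOpen_univ : IsRegularOpen (univ : Set X) := by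
  simp [IsRegularOpen, perp]

theorem isRegularOpen_eval {V : ℕ → Set X} (hV : ∀ p, IsRegularOpen (V p)) :
    ∀ φ : Formula, IsRegularOpen (φ.eval V)
  | .letter p => hV p
  | .bot => isRegularOpen_empty
  | .neg φ => isRegularOpen_perp (isRegularOpen_eval hV φ).isOpen
  | .and φ ψ => (isRegularOpen_eval hV φ).inter (isRegularOpen_eval hV ψ)
  | .strict φ ψ => by
      unfold Formula.eval
      split_ifs
      exacts [isRegularOpen_univ, isRegularOpen_empty]

/-! ### Classical valuations and the tautology axioms. -/

/-- Classical truth assignments, with the formulas `φ ⇝ ψ` as atoms. -/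
structure IsValuation (v : Formula → Prop) : Prop where
  bot : ¬ v .bot
  neg : ∀ α, v (.neg α) ↔ ¬ v α
  and : ∀ α β, v (.and α β) ↔ v α ∧ v β

namespace IsValuation

variable {v : Formula → Prop} (hv : IsValuation v)
include hv

theorem top : v .top := (hv.neg _).2 hv.bot

theorem imp (α β : Formula) : v (.imp α β) ↔ (v α → v β) := by
  simp only [Formula.imp, hv.neg, hv.and]; tauto

theorem or (α β : Formula) : v (.or α β) ↔ (v α ∨ v β) := by
  simp only [Formula.or, hv.neg, hv.and]; tauto

theorem iff (α β : Formula) : v (.iff α β) ↔ (v α ↔ v β) := by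
  simp only [Formula.iff, hv.imp, hv.and]; tauto

end IsValuation

variable (X) in
/-- The filter of sets with dense interior. -/
def denseInterior : Filter X where
  sets := {S | Dense (interior S)}
  univ_sets := by simp
  sets_of_superset h hs := h.mono (interior_mono hs)
  inter_sets h h' := by
    simp only [mem_ofPred_eq, interior_inter]
    exact Dense.inter_of_isOpen_left h h' isOpen_interior

theorem dense_union_perp (U : Set X) : Dense (U ∪ perp U) := by
  intro x
  rw [closure_union]
  by_cases h : x ∈ closure U
  · exact Or.inl h
  · exact Or.inr (subset_closure h)

/-- An ultrafilter containing all dense open sets induces a valuation. -/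
theorem isValuation_of_ultrafilter {V : ℕ → Set X} (hV : ∀ p, IsRegularOpen (V p))
    (F : Ultrafilter X) (hF : (F : Filter X) ≤ denseInterior X) :
    IsValuation fun φ => φ.eval V ∈ F where
  bot := F.empty_notMem
  neg α := by
    have hd : α.eval V ∪ perp (α.eval V) ∈ F := by
      refine hF ?_
      change Dense (interior _)
      rw [((isRegularOpen_eval hV α).isOpen.union (isOpen_perp _)).interior_eq]
      exact dense_union_perp _
    rw [Ultrafilter.union_mem_iff] at hd
    refine ⟨fun h h' => ?_, fun h => hd.resolve_left h⟩
    refine F.empty_notMem (Filter.mem_of_superset (Filter.inter_mem h h') ?_)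
    exact fun x hx => hx.1 (subset_closure hx.2)
  and α β := Filter.inter_mem_iff

/-- Otherwise the negation has a nonempty open value. Such a set meets every dense open set, so some
ultrafilter contains it together with all dense open sets, and the induced valuation refutes the
tautology. -/
theorem eval_eq_univ_of_taut {V : ℕ → Set X} (hV : ∀ p, IsRegularOpen (V p)) {φ : Formula}
    (hφ : φ.IsTautology) : φ.eval V = univ := by
  by_contra hne
  have hO : (perp (φ.eval V)).Nonempty := by
    rw [nonempty_iff_ne_empty]
    intro h
    apply hne
    rw [← isRegularOpen_eval hV φ, h]
    simp [perp]
  have : (denseInterior X ⊓ Filter.principal (perp (φ.eval V))).NeBot := by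
    rw [Filter.inf_principal_neBot_iff]
    intro S hS
    have h := Dense.inter_open_nonempty (s := interior S) hS _ (isOpen_perp _) hO
    exact h.mono fun x hx => ⟨interior_subset hx.2, hx.1⟩
  let F := Ultrafilter.of (denseInterior X ⊓ Filter.principal (perp (φ.eval V)))
  have hle := Ultrafilter.of_le (denseInterior X ⊓ Filter.principal (perp (φ.eval V)))
  have hv := isValuation_of_ultrafilter hV F (hle.trans inf_le_left)
  have h1 : φ.eval V ∈ F := hφ (fun φ => φ.eval V ∈ F) hv.bot hv.neg hv.and
  have h2 : perp (φ.eval V) ∈ F := hle (Filter.mem_inf_of_right (Filter.mem_principal_self _))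
  exact (hv.neg φ).1 h2 h1

theorem eval_top (V : ℕ → Set X) : Formula.top.eval V = univ := by
  simp [Formula.top, Formula.eval, perp]

theorem eval_imp_eq_univ {V : ℕ → Set X} (hV : ∀ p, IsRegularOpen (V p)) {φ ψ : Formula} :
    (φ.imp ψ).eval V = univ ↔ φ.eval V ⊆ ψ.eval V := by
  have hφ := isRegularOpen_eval hV φ
  have hψ := isRegularOpen_eval hV ψ
  simp only [Formula.imp, Formula.eval]
  constructor
  · intro h x hx
    by_contra hx'
    have h1 : x ∈ closure (perp (ψ.eval V)) := by
      rw [closure_perp_of_regular hψ]; exact hx'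
    obtain ⟨y, hy, hy'⟩ := mem_closure_iff.1 h1 _ hφ.isOpen hx
    have hmem : y ∈ perp (φ.eval V ∩ perp (ψ.eval V)) := by rw [h]; exact mem_univ y
    exact hmem (subset_closure ⟨hy, hy'⟩)
  · intro h
    have : φ.eval V ∩ perp (ψ.eval V) = ∅ := by
      ext x
      simp only [mem_inter_iff, mem_empty_iff_false, iff_false, not_and]
      exact fun hx hx' => hx' (subset_closure (h hx))
    rw [this]; simp [perp]

theorem eval_iff_eq_univ {V : ℕ → Set X} (hV : ∀ p, IsRegularOpen (V p)) {φ ψ : Formula} :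
    (φ.iff ψ).eval V = univ ↔ φ.eval V = ψ.eval V := by
  rw [Formula.iff, Formula.eval, inter_eq_univ_iff, eval_imp_eq_univ hV, eval_imp_eq_univ hV,
    Subset.antisymm_iff]

/-- The join of two regular open sets may exceed their union, but only within the closure of that
union. -/
theorem closure_eval_or {V : ℕ → Set X} (hV : ∀ p, IsRegularOpen (V p)) (φ ψ : Formula) :
    closure ((φ.or ψ).eval V) = closure (φ.eval V) ∪ closure (ψ.eval V) := by
  have hφ := isRegularOpen_eval hV φ
  have hψ := isRegularOpen_eval hV ψ
  simp only [Formula.or, Formula.eval]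
  rw [closure_perp_of_regular ((isRegularOpen_perp hφ.isOpen).inter (isRegularOpen_perp hψ.isOpen)),
    compl_inter, perp, perp, compl_compl, compl_compl]

/-! ### The relation `≪` on regular open sets. -/

theorem WayBelow.subset {U V : Set X} (hU : IsOpen U) (hV : IsOrderRegularOpen V)
    (h : WayBelow U V) : U ⊆ V := by
  intro x hx
  rw [← hV]
  exact fun y hxy => h (subset_closure (hxy U hU hx))

/-- By order-regularity, a point outside `V` lies below some point outside `down V`, which is
therefore outside `closure U`. -/
theorem WayBelow.perp {U V : Set X} (hV : IsRegularOpen V) (hV' : IsOrderRegularOpen V)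
    (h : WayBelow U V) : WayBelow (perp V) (perp U) := by
  intro x hx
  rw [closure_perp_of_regular hV, mem_compl_iff] at hx
  rw [← hV'] at hx
  simp only [upInterior, mem_ofPred_eq, not_forall] at hx
  obtain ⟨y, hxy, hy⟩ := hx
  exact ⟨y, fun hy' => hy (h hy'), hxy⟩

theorem wayBelow_perp_perp_iff (hX : ∀ U : Set X, IsRegularOpen U → IsOrderRegularOpen U)
    {U V : Set X} (hU : IsRegularOpen U) (hV : IsRegularOpen V) :
    WayBelow (perp V) (perp U) ↔ WayBelow U V := by
  refine ⟨fun h => ?_, fun h => h.perp hV (hX _ hV)⟩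
  have := h.perp (isRegularOpen_perp hU.isOpen) (hX _ (isRegularOpen_perp hU.isOpen))
  rwa [hU, hV] at this

/-- The operator `down` need not commute with intersections. Contraposition moves the problem to
closures, which commute with unions. -/
theorem wayBelow_inter_iff (hX : ∀ U : Set X, IsRegularOpen U → IsOrderRegularOpen U)
    {U V W : Set X} (hU : IsRegularOpen U) (hV : IsRegularOpen V) (hW : IsRegularOpen W) :
    WayBelow U (V ∩ W) ↔ WayBelow U V ∧ WayBelow U W := by
  rw [← wayBelow_perp_perp_iff hX hU hV, ← wayBelow_perp_perp_iff hX hU hW,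
    ← wayBelow_perp_perp_iff hX hU (hV.inter hW)]
  have : closure (perp (V ∩ W)) = closure (perp V) ∪ closure (perp W) := by
    rw [closure_perp_of_regular hV, closure_perp_of_regular hW,
      closure_perp_of_regular (hV.inter hW), compl_inter]
  rw [WayBelow, this, union_subset_iff]
  rfl

theorem eval_strict_of_wayBelow {V : ℕ → Set X} {φ ψ : Formula}
    (h : WayBelow (φ.eval V) (ψ.eval V)) : (φ.strict ψ).eval V = univ :=
  if_pos h

theorem eval_strict_of_not_wayBelow {V : ℕ → Set X} {φ ψ : Formula}
    (h : ¬ WayBelow (φ.eval V) (ψ.eval V)) : (φ.strict ψ).eval V = ∅ :=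
  if_neg h

theorem eval_strict_eq_or (V : ℕ → Set X) (φ ψ : Formula) :
    (φ.strict ψ).eval V = univ ∨ (φ.strict ψ).eval V = ∅ := by
  by_cases h : WayBelow (φ.eval V) (ψ.eval V)
  exacts [Or.inl (eval_strict_of_wayBelow h), Or.inr (eval_strict_of_not_wayBelow h)]

theorem eval_strict_congr {V : ℕ → Set X} {α β γ δ : Formula}
    (h : WayBelow (α.eval V) (β.eval V) ↔ WayBelow (γ.eval V) (δ.eval V)) :
    (α.strict β).eval V = (γ.strict δ).eval V := by
  by_cases h' : WayBelow (α.eval V) (β.eval V)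
  · rw [eval_strict_of_wayBelow h', eval_strict_of_wayBelow (h.1 h')]
  · rw [eval_strict_of_not_wayBelow h', eval_strict_of_not_wayBelow (fun k => h' (h.2 k))]

theorem eval_strict_eq_inter {V : ℕ → Set X} {α β γ δ γ' δ' : Formula}
    (h : WayBelow (α.eval V) (β.eval V) ↔
      WayBelow (γ.eval V) (δ.eval V) ∧ WayBelow (γ'.eval V) (δ'.eval V)) :
    (α.strict β).eval V = ((γ.strict δ).and (γ'.strict δ')).eval V := by
  simp only [WayBelow] at h
  simp only [Formula.eval, h]
  split_ifs <;> simp_all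

theorem eval_box_of_eq_univ {V : ℕ → Set X} {φ : Formula} (h : φ.eval V = univ) :
    φ.box.eval V = univ :=
  eval_strict_of_wayBelow fun x _ => by rw [h]; exact subset_down _ (mem_univ x)

theorem eval_box_of_eq_empty {V : ℕ → Set X} {φ : Formula} (h : φ.eval V = ∅) :
    φ.box.eval V = ∅ := by
  rcases isEmpty_or_nonempty X with hX | ⟨⟨x⟩⟩
  · exact eq_empty_of_isEmpty _
  refine eval_strict_of_not_wayBelow fun h' => ?_
  rw [eval_top, h, WayBelow, down_empty, closure_univ] at h'
  exact h' (mem_univ x)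

theorem S2IC.sound {φ : Formula} (h : S2IC φ)
    (hX : ∀ U : Set X, IsRegularOpen U → IsOrderRegularOpen U) : Valid X φ := by
  intro V hV
  rcases isEmpty_or_nonempty X with hE | hE
  · exact Subsingleton.elim _ _
  have hreg := isRegularOpen_eval hV
  induction h with
  | taut φ h => exact eval_eq_univ_of_taut hV h
  | bounds φ =>
    rw [Formula.eval, inter_eq_univ_iff]
    refine ⟨eval_strict_of_wayBelow ?_, eval_strict_of_wayBelow ?_⟩
    · simp [WayBelow, Formula.eval]
    · rw [eval_top]
      exact fun x _ => subset_down _ (mem_univ x)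
  | or_left φ ψ χ =>
    rw [eval_iff_eq_univ hV]
    apply eval_strict_eq_inter
    simp only [WayBelow, closure_eval_or hV, union_subset_iff]
  | and_right φ ψ χ =>
    rw [eval_iff_eq_univ hV]
    exact eval_strict_eq_inter (wayBelow_inter_iff hX (hreg _) (hreg _) (hreg _))
  | strict_imp φ ψ =>
    rw [eval_imp_eq_univ hV]
    by_cases h : WayBelow (φ.eval V) (ψ.eval V)
    · rw [(eval_imp_eq_univ hV).2 (h.subset (hreg _).isOpen (hX _ (hreg _)))]
      exact subset_univ _
    · rw [eval_strict_of_not_wayBelow h]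
      exact empty_subset _
  | symmetry φ ψ =>
    rw [eval_iff_eq_univ hV]
    exact eval_strict_congr (wayBelow_perp_perp_iff hX (hreg _) (hreg _)).symm
  | four φ =>
    rw [eval_imp_eq_univ hV]
    rcases eval_strict_eq_or V .top φ with h | h
    · rw [eval_box_of_eq_univ (φ := φ.box) h]; exact subset_univ _
    · rw [Formula.box, h]; exact empty_subset _
  | five φ =>
    rw [eval_imp_eq_univ hV]
    rcases eval_strict_eq_or V .top φ with h | h
    · rw [Formula.eval, Formula.box, h]; simp [perp]
    · rw [eval_box_of_eq_univ (φ := .neg φ.box)]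
      · exact subset_univ _
      · rw [Formula.eval, Formula.box, h]; simp [perp]
  | strict_box φ ψ =>
    rw [eval_iff_eq_univ hV]
    rcases eval_strict_eq_or V φ ψ with h | h
    · rw [eval_box_of_eq_univ h, h]
    · rw [eval_box_of_eq_empty h, h]
  | box_bot φ =>
    rw [eval_imp_eq_univ hV]
    rcases eval_strict_eq_or V .top φ with h | h
    · rw [eval_strict_of_wayBelow (φ := .neg φ.box)]
      · exact subset_univ _
      · have : (Formula.neg φ.box).eval V = ∅ := by
          rw [Formula.eval, Formula.box, h]; simp [perp]
        rw [WayBelow, this]; simp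
    · rw [Formula.box, h]; exact empty_subset _
  | modus_ponens φ ψ _ _ h h' =>
    rw [eval_imp_eq_univ hV, h'] at h
    exact univ_subset_iff.1 h
  | necessitation φ _ h => exact eval_box_of_eq_univ h
  | congruence φ φ' ψ ψ' _ _ h h' =>
    rw [eval_iff_eq_univ hV] at h h' ⊢
    apply eval_strict_congr
    rw [h, h']

end Soundness

/-! ### The space of nonempty closed subsets of a compact Hausdorff space -/

section UpperVietoris

/-- Nonempty closed subsets, to carry the upper Vietoris topology. -/
structure ClosedSet (Z : Type u) [TopologicalSpace Z] : Type u where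
  carrier : Set Z
  isClosed : IsClosed carrier
  nonempty : carrier.Nonempty

namespace ClosedSet

variable {Z : Type u} [TopologicalSpace Z]

/-- The nonempty closed sets contained in `U`. -/
def inside (U : Set Z) : Set (ClosedSet Z) := {C | C.carrier ⊆ U}

@[simp] theorem mem_inside {U : Set Z} {C : ClosedSet Z} : C ∈ inside U ↔ C.carrier ⊆ U := Iff.rfl

theorem inside_inter (U V : Set Z) : inside (U ∩ V) = inside U ∩ inside V := by
  ext C; exact subset_inter_iff

theorem inside_univ : inside (univ : Set Z) = univ := by
  ext C; simp

theorem inside_empty : inside (∅ : Set Z) = ∅ := by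
  ext C; simpa [subset_empty_iff] using C.nonempty.ne_empty

/-- The upper Vietoris topology. -/
instance : TopologicalSpace (ClosedSet Z) where
  IsOpen S := ∀ C ∈ S, ∃ U, IsOpen U ∧ C.carrier ⊆ U ∧ inside U ⊆ S
  isOpen_univ C _ := ⟨univ, isOpen_univ, subset_univ _, subset_univ _⟩
  isOpen_inter S T hS hT C hC := by
    obtain ⟨U, hU, hCU, hUS⟩ := hS C hC.1
    obtain ⟨V, hV, hCV, hVT⟩ := hT C hC.2
    refine ⟨U ∩ V, hU.inter hV, subset_inter hCU hCV, ?_⟩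
    rw [inside_inter]
    exact inter_subset_inter hUS hVT
  isOpen_sUnion 𝒮 h C := by
    rintro ⟨S, hS, hC⟩
    obtain ⟨U, hU, hCU, hUS⟩ := h S hS C hC
    exact ⟨U, hU, hCU, hUS.trans (subset_sUnion_of_mem hS)⟩

theorem isOpen_inside {U : Set Z} (hU : IsOpen U) : IsOpen (inside U) :=
  fun _ hC => ⟨U, hU, hC, Subset.rfl⟩

theorem mem_closure_iff_inside {S : Set (ClosedSet Z)} {C : ClosedSet Z} :
    C ∈ closure S ↔ ∀ U, IsOpen U → C.carrier ⊆ U → (inside U ∩ S).Nonempty := by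
  rw [mem_closure_iff]
  refine ⟨fun h U hU hC => h _ (isOpen_inside hU) hC, fun h O hO hC => ?_⟩
  obtain ⟨U, hU, hCU, hUO⟩ := hO C hC
  exact (h U hU hCU).mono (inter_subset_inter_left _ hUO)

variable [T2Space Z]

/-- A point, as a nonempty closed set. -/
def point (z : Z) : ClosedSet Z := ⟨{z}, isClosed_singleton, singleton_nonempty z⟩

@[simp] theorem carrier_point (z : Z) : (point z).carrier = {z} := rfl

theorem inside_subset_inside {U V : Set Z} : inside U ⊆ inside V ↔ U ⊆ V := by
  refine ⟨fun h z hz => ?_, fun h C hC => Subset.trans hC h⟩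
  have : point z ∈ inside V := h (by simpa using hz)
  simpa using this

theorem inside_injective : Function.Injective (inside : Set Z → Set (ClosedSet Z)) :=
  fun _ _ h => Subset.antisymm (inside_subset_inside.1 h.subset) (inside_subset_inside.1 h.superset)

theorem isOpen_setOf_point {S : Set (ClosedSet Z)} (hS : IsOpen S) :
    IsOpen {z | point z ∈ S} := by
  rw [_root_.isOpen_iff_forall_mem_open]
  intro z hz
  obtain ⟨U, hU, hzU, hUS⟩ := hS _ hz
  exact ⟨U, fun w hw => hUS (by simpa using hw), hU, by simpa using hzU⟩

/-- Complements of points are open in `Z`, so the open sets `inside {z}ᶜ` detect every missing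
point. Singletons are thus the maximal elements of the order. -/
theorem specLE_iff {C D : ClosedSet Z} : SpecLE C D ↔ D.carrier ⊆ C.carrier := by
  refine ⟨fun h z hz => ?_, fun h S hS hC => ?_⟩
  · by_contra hzC
    have := h (inside {z}ᶜ) (isOpen_inside isOpen_compl_singleton)
      (subset_compl_singleton_iff.2 hzC)
    exact this hz rfl
  · obtain ⟨U, _, hCU, hUS⟩ := hS C hC
    exact hUS (h.trans hCU)

theorem down_inside (U : Set Z) : down (inside U) = {C | (C.carrier ∩ U).Nonempty} := by
  ext C
  constructor
  · rintro ⟨D, hD, hCD⟩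
    obtain ⟨z, hz⟩ := D.nonempty
    exact ⟨z, specLE_iff.1 hCD hz, hD hz⟩
  · rintro ⟨z, hz, hzU⟩
    exact ⟨point z, by simpa using hzU, specLE_iff.2 (by simpa using hz)⟩

/-- A closed set all of whose nonempty closed subsets meet `U` is contained in `U`: test on
singletons. -/
theorem upInterior_down_inside (U : Set Z) : upInterior (down (inside U)) = inside U := by
  rw [down_inside]
  ext C
  constructor
  · intro h z hz
    obtain ⟨w, hw, hwU⟩ := h (point z) (specLE_iff.2 (by simpa using hz))
    rw [carrier_point, mem_singleton_iff] at hw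
    exact hw ▸ hwU
  · intro h D hD
    obtain ⟨z, hz⟩ := D.nonempty
    exact ⟨z, hz, h (specLE_iff.1 hD hz)⟩

theorem upInterior_compl_inside (U : Set Z) : upInterior (inside U)ᶜ = inside Uᶜ := by
  ext C
  constructor
  · intro h z hz hzU
    exact h (point z) (specLE_iff.2 (by simpa using hz)) (by simpa using hzU)
  · intro h D hD hDU
    obtain ⟨z, hz⟩ := D.nonempty
    exact h (specLE_iff.1 hD hz) (hDU hz)

/-! ### Closures, regular open sets and `≪` over a compact Hausdorff space. -/

variable [CompactSpace Z]

/-- The closure of an open set of nonempty closed sets, in terms of the points in it. -/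
theorem closure_of_isOpen {S : Set (ClosedSet Z)} (hS : IsOpen S) :
    closure S = {C | (C.carrier ∩ closure {z | point z ∈ S}).Nonempty} := by
  ext C
  rw [mem_closure_iff_inside]
  constructor
  · intro h
    by_contra hC
    rw [mem_ofPred_eq, not_nonempty_iff_eq_empty, ← disjoint_iff_inter_eq_empty] at hC
    -- If `C` misses the closure of the points of `S`, normality separates the two. A member of `S`
    -- inside `U` would have its own points in `S`, hence in `V`.
    obtain ⟨U, V, hU, hV, hCU, hSV, hUV⟩ :=
      normal_separation C.isClosed isClosed_closure hC
    obtain ⟨D, hDU, hDS⟩ := h U hU hCU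
    obtain ⟨W, _, hDW, hWS⟩ := hS D hDS
    obtain ⟨z, hz⟩ := D.nonempty
    have hzS : point z ∈ S := hWS (by simpa using hDW hz)
    exact disjoint_left.1 hUV (hDU hz) (hSV (subset_closure hzS))
  · rintro ⟨z, hzC, hz⟩ U hU hCU
    obtain ⟨w, hwU, hwS⟩ := mem_closure_iff.1 hz U hU (hCU hzC)
    exact ⟨point w, by simpa using hwU, hwS⟩

theorem closure_inside {U : Set Z} (hU : IsOpen U) :
    closure (inside U) = {C | (C.carrier ∩ closure U).Nonempty} := by
  rw [closure_of_isOpen (isOpen_inside hU)]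
  simp

theorem perp_of_isOpen {S : Set (ClosedSet Z)} (hS : IsOpen S) :
    perp S = inside (perp {z | point z ∈ S}) := by
  rw [perp, closure_of_isOpen hS]
  ext C
  rw [mem_compl_iff, mem_ofPred_eq, not_nonempty_iff_eq_empty, ← disjoint_iff_inter_eq_empty,
    mem_inside, perp, subset_compl_iff_disjoint_right]

theorem perp_inside {U : Set Z} (hU : IsOpen U) : perp (inside U) = inside (perp U) := by
  rw [perp_of_isOpen (isOpen_inside hU)]
  simp

theorem isRegularOpen_inside {U : Set Z} (hU : IsRegularOpen U) : IsRegularOpen (inside U) := by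
  rw [IsRegularOpen, perp_inside hU.isOpen, perp_inside (isOpen_perp U), hU]

/-- A regular open set is the `perp` of an open set, and those always have the form `inside _`. -/
theorem exists_of_isRegularOpen {S : Set (ClosedSet Z)} (hS : IsRegularOpen S) :
    ∃ U, IsRegularOpen U ∧ S = inside U :=
  ⟨_, isRegularOpen_perp (isOpen_setOf_point (isOpen_perp S)),
    hS.symm.trans (perp_of_isOpen (isOpen_perp S))⟩

theorem wayBelow_inside {U V : Set Z} (hU : IsOpen U) :
    WayBelow (inside U) (inside V) ↔ closure U ⊆ V := by
  rw [WayBelow, closure_inside hU, down_inside]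
  constructor
  · intro h z hz
    obtain ⟨w, hw, hwV⟩ := @h (point z) ⟨z, rfl, hz⟩
    rw [carrier_point, mem_singleton_iff] at hw
    exact hw ▸ hwV
  · rintro h C ⟨z, hz, hzU⟩
    exact ⟨z, hz, h hzU⟩

theorem exists_regular_between {C U : Set Z} (hC : IsClosed C) (hU : IsOpen U) (h : C ⊆ U) :
    ∃ W, IsRegularOpen W ∧ C ⊆ W ∧ closure W ⊆ U := by
  obtain ⟨O, hO, hCO, hOU⟩ := normal_exists_closure_subset hC hU h
  refine ⟨perp (perp O), isRegularOpen_perp (isOpen_perp O), hCO.trans (subset_perp_perp hO), ?_⟩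
  refine (closure_minimal ?_ isClosed_closure).trans hOU
  rw [perp_eq_interior_compl (perp O), perp, compl_compl]
  exact interior_subset

theorem isROFilter_roNhds {X : Type u} [TopologicalSpace X] (x : X) : IsROFilter (roNhds x) where
  regular _ h := h.1
  univ_mem := ⟨isRegularOpen_univ, mem_univ x⟩
  empty_notMem h := h.2
  mem_of_subset _ _ hU hV h := ⟨hV, h hU.2⟩
  inter_mem _ _ hU hV := ⟨hU.1.inter hV.1, hU.2, hV.2⟩

/-- The realizing point is the intersection of the closures of all `W` with `inside W ∈ F`. It is
nonempty by compactness, the family being directed and `F` proper. -/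
theorem roundPart_eq_roNhds {F : Set (Set (ClosedSet Z))} (hF : IsROFilter F) :
    ∃ C, roundPart F = roNhds C := by
  let ι := {W : Set Z // inside W ∈ F}
  have : Nonempty ι := ⟨⟨univ, by rw [inside_univ]; exact hF.univ_mem⟩⟩
  have hdir : Directed (· ⊇ ·) fun W : ι => closure W.1 := by
    rintro ⟨U, hU⟩ ⟨V, hV⟩
    refine ⟨⟨U ∩ V, ?_⟩, closure_mono inter_subset_left, closure_mono inter_subset_right⟩
    rw [inside_inter]
    exact hF.inter_mem _ _ hU hV
  have hne : (⋂ W : ι, closure W.1).Nonempty := by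
    refine IsCompact.nonempty_iInter_of_directed_nonempty_isCompact_isClosed _ hdir ?_
      (fun _ => isClosed_closure.isCompact) (fun _ => isClosed_closure)
    rintro ⟨W, hW⟩
    rw [closure_nonempty_iff, nonempty_iff_ne_empty]
    rintro rfl
    rw [inside_empty] at hW
    exact hF.empty_notMem hW
  refine ⟨⟨_, isClosed_iInter fun _ => isClosed_closure, hne⟩, ?_⟩
  ext S
  constructor
  · rintro ⟨hS, T, hT, hTS⟩
    refine ⟨hF.regular S hS, ?_⟩
    obtain ⟨U, hU, rfl⟩ := exists_of_isRegularOpen (hF.regular S hS)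
    obtain ⟨W, hW, rfl⟩ := exists_of_isRegularOpen (hF.regular T hT)
    rw [wayBelow_inside hW.isOpen] at hTS
    exact (iInter_subset (fun W : ι => closure W.1) ⟨W, hT⟩).trans hTS
  · rintro ⟨hS, hCS⟩
    obtain ⟨U, hU, rfl⟩ := exists_of_isRegularOpen hS
    -- Compactness again: an open set containing the whole intersection already contains one of the
    -- closures.
    obtain ⟨⟨W, hW⟩, hWU⟩ := exists_subset_nhds_of_compactSpace hdir
      (fun _ => isClosed_closure) (fun z hz => hU.isOpen.mem_nhds (hCS hz))
    refine ⟨hF.mem_of_subset _ _ hW hS (inside_subset_inside.2 (subset_closure.trans hWU)),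
      inside W, hW, ?_⟩
    obtain ⟨W', hW', h⟩ := exists_of_isRegularOpen (hF.regular _ hW)
    obtain rfl := inside_injective h
    exact (wayBelow_inside hW'.isOpen).2 hWU

/-- The closed set `Uᶜ`, when nonempty, is itself a point outside `A`, so some open `W ⊇ Uᶜ` has
`inside W` disjoint from `A`. Shrinking `W` to `O` by normality of `Z` makes each member of `A`
leave `closure O`. -/
theorem isOrderNormal : IsOrderNormal (ClosedSet Z) := by
  intro A B hA hB hAB
  obtain ⟨U, hU, hBU⟩ := exists_of_isRegularOpen hB
  obtain rfl : B = (inside U)ᶜ := by rw [← hBU, compl_compl]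
  rw [upInterior_compl_inside] at hAB ⊢
  obtain ⟨W, hW, hUW, hWA⟩ : ∃ W, IsOpen W ∧ Uᶜ ⊆ W ∧ inside W ⊆ Aᶜ := by
    rcases (Uᶜ).eq_empty_or_nonempty with h | h
    · exact ⟨∅, isOpen_empty, h.subset, by simp [inside_empty]⟩
    · exact hA.isOpen_compl ⟨Uᶜ, hU.isOpen.isClosed_compl, h⟩
        fun hmem => disjoint_left.1 hAB hmem (mem_inside.2 Subset.rfl)
  obtain ⟨O, hO, hUO, hOW⟩ := normal_exists_closure_subset hU.isOpen.isClosed_compl hW hUW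
  refine ⟨inside (closure O)ᶜ, inside O, isOpen_inside isClosed_closure.isOpen_compl,
    isOpen_inside hO, ?_, ?_, inside_subset_inside.2 hUO⟩
  · rw [disjoint_left]
    intro C hC hCO
    obtain ⟨z, hz⟩ := C.nonempty
    exact hC hz (subset_closure (hCO hz))
  · intro C hC
    rw [down_inside, mem_ofPred_eq, inter_compl_nonempty_iff]
    exact fun h => hWA (mem_inside.2 (h.trans hOW)) hC

theorem isDVSpace : IsDVSpace (ClosedSet Z) where
  t0 := by
    refine ⟨fun C D h => ?_⟩
    have h1 : C.carrier = D.carrier := Subset.antisymm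
      (specLE_iff.1 fun U hU hD => (h.mem_open_iff hU).2 hD)
      (specLE_iff.1 fun U hU hC => (h.mem_open_iff hU).1 hC)
    cases C; cases D; cases h1; rfl
  compact := by
    rcases isEmpty_or_nonempty Z with hZ | hZ
    · have : IsEmpty (ClosedSet Z) := ⟨fun C => hZ.elim C.nonempty.some⟩
      infer_instance
    -- The whole of `Z` is the least element, so any open set containing it is everything and one
    -- member of a cover suffices.
    let C₀ : ClosedSet Z := ⟨univ, isClosed_univ, univ_nonempty⟩
    refine ⟨?_⟩
    refine isCompact_of_finite_subcover fun {ι} S hS hcov => ?_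
    obtain ⟨i, hi⟩ := mem_iUnion.1 (hcov (mem_univ C₀))
    refine ⟨{i}, fun C _ => ?_⟩
    simpa using (specLE_iff (C := C₀) (D := C)).2 (subset_univ _) (S i) (hS i) hi
  orderNormal := isOrderNormal
  basis := by
    refine TopologicalSpace.isTopologicalBasis_of_isOpen_of_nhds (fun _ h => h.isOpen) ?_
    intro C S hC hS
    obtain ⟨U, hU, hCU, hUS⟩ := hS C hC
    obtain ⟨W, hW, hCW, hWU⟩ := exists_regular_between C.isClosed hU hCU
    exact ⟨inside W, isRegularOpen_inside hW, hCW,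
      (inside_subset_inside.2 (subset_closure.trans hWU)).trans hUS⟩
  orderRegular S hS := by
    obtain ⟨U, _, rfl⟩ := exists_of_isRegularOpen hS
    exact upInterior_down_inside U
  concordant C := by
    refine ⟨isROFilter_roNhds C, Subset.antisymm (fun S h => h.1) fun S hS => ⟨hS, ?_⟩⟩
    obtain ⟨hS, hC⟩ := hS
    obtain ⟨U, hU, rfl⟩ := exists_of_isRegularOpen hS
    obtain ⟨W, hW, hCW, hWU⟩ := exists_regular_between C.isClosed hU.isOpen hC
    exact ⟨inside W, ⟨isRegularOpen_inside hW, hCW⟩, (wayBelow_inside hW.isOpen).2 hWU⟩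
  realized _ hF := roundPart_eq_roNhds hF

/-- A map from formulas to regular open sets of `Z` that respects the connectives induces a
de Vries topological model on the nonempty closed sets of `Z`. -/
theorem eval_eq_inside {S : Formula → Set Z} (hopen : ∀ φ, IsOpen (S φ)) (hbot : S .bot = ∅)
    (hneg : ∀ φ, S (.neg φ) = perp (S φ)) (hand : ∀ φ ψ, S (.and φ ψ) = S φ ∩ S ψ)
    (hpos : ∀ φ ψ, closure (S φ) ⊆ S ψ → S (.strict φ ψ) = univ)
    (hnot : ∀ φ ψ, ¬ closure (S φ) ⊆ S ψ → S (.strict φ ψ) = ∅) (φ : Formula) :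
    φ.eval (fun p => inside (S (.letter p))) = inside (S φ) := by
  induction φ with
  | letter p => rfl
  | bot => rw [hbot, inside_empty]; rfl
  | neg φ ih => rw [hneg, ← perp_inside (hopen φ), ← ih]; rfl
  | and φ ψ ihφ ihψ => rw [hand, inside_inter, ← ihφ, ← ihψ]; rfl
  | strict φ ψ ihφ ihψ =>
    by_cases h : closure (S φ) ⊆ S ψ
    · rw [hpos φ ψ h, inside_univ]
      refine eval_strict_of_wayBelow ?_
      rwa [ihφ, ihψ, wayBelow_inside (hopen φ)]
    · rw [hnot φ ψ h, inside_empty]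
      refine eval_strict_of_not_wayBelow ?_
      rwa [ihφ, ihψ, wayBelow_inside (hopen φ)]

end ClosedSet

end UpperVietoris

/-! ### Theories and maximal consistent sets -/

section Canonical

/-- Sets of formulas closed under classical propositional consequence. -/
structure IsTheory (Δ : Set Formula) : Prop where
  taut : ∀ φ : Formula, φ.IsTautology → φ ∈ Δ
  mp : ∀ φ ψ : Formula, φ.imp ψ ∈ Δ → φ ∈ Δ → ψ ∈ Δ

namespace IsTheory

variable {Δ : Set Formula}

theorem of_taut_imp (h : IsTheory Δ) {φ ψ : Formula} (hφ : φ ∈ Δ)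
    (ht : ∀ v, IsValuation v → v φ → v ψ) : ψ ∈ Δ :=
  h.mp φ ψ (h.taut _ fun v hb hn ha => (IsValuation.imp ⟨hb, hn, ha⟩ _ _).2 (ht v ⟨hb, hn, ha⟩)) hφ

theorem of_taut_imp₂ (h : IsTheory Δ) {φ ψ χ : Formula} (hφ : φ ∈ Δ) (hψ : ψ ∈ Δ)
    (ht : ∀ v, IsValuation v → v φ → v ψ → v χ) : χ ∈ Δ :=
  h.mp ψ χ (h.of_taut_imp hφ fun v hv hvφ => (hv.imp _ _).2 (ht v hv hvφ)) hψ

/-- The theory generated by adding a formula. -/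
theorem adjoin (h : IsTheory Δ) (γ : Formula) : IsTheory {δ | γ.imp δ ∈ Δ} where
  taut φ hφ := h.taut _ fun v hb hn ha =>
    (IsValuation.imp ⟨hb, hn, ha⟩ _ _).2 fun _ => hφ v hb hn ha
  mp φ ψ h1 h2 := h.of_taut_imp₂ h1 h2 fun v hv => by simp only [hv.imp]; tauto

/-- Lindenbaum's lemma. -/
theorem exists_valuation (h : IsTheory Δ) {β : Formula} (hβ : β ∉ Δ) :
    ∃ w, IsValuation w ∧ (∀ φ ∈ Δ, w φ) ∧ ¬ w β := by
  obtain ⟨M, hΔM, hM⟩ := zorn_subset_nonempty {M | IsTheory M ∧ β ∉ M} (fun c hc hchain hne => by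
    refine ⟨⋃₀ c, ⟨⟨fun φ hφ => ?_, ?_⟩, ?_⟩, fun s hs => subset_sUnion_of_mem hs⟩
    · obtain ⟨s, hs⟩ := hne
      exact ⟨s, hs, (hc hs).1.taut φ hφ⟩
    · rintro φ ψ ⟨s, hs, h1⟩ ⟨t, ht, h2⟩
      rcases hchain.total hs ht with hst | hts
      · exact ⟨t, ht, (hc ht).1.mp φ ψ (hst h1) h2⟩
      · exact ⟨s, hs, (hc hs).1.mp φ ψ h1 (hts h2)⟩
    · rintro ⟨s, hs, hβs⟩
      exact (hc hs).2 hβs) Δ ⟨h, hβ⟩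
  obtain ⟨hMT, hβM⟩ := hM.prop
  -- By maximality, adjoining a formula outside `M` must bring in `β`.
  have hmax : ∀ γ, γ ∉ M → γ.imp β ∈ M := fun γ hγ => by
    by_contra hγβ
    refine hγ (hM.le_of_ge (y := {δ | γ.imp δ ∈ M}) ⟨hMT.adjoin γ, hγβ⟩ (fun δ hδ => ?_) ?_)
    · exact hMT.of_taut_imp hδ fun v hv hvδ => (hv.imp _ _).2 fun _ => hvδ
    · exact hMT.taut _ fun v hb hn ha => (IsValuation.imp ⟨hb, hn, ha⟩ _ _).2 id
  refine ⟨(· ∈ M), ⟨fun hb => ?_, fun α => ⟨fun h1 h2 => ?_, fun h1 => ?_⟩, fun α γ =>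
    ⟨fun h1 => ⟨?_, ?_⟩, fun h1 => ?_⟩⟩, fun φ hφ => hΔM hφ, hβM⟩
  · exact hβM (hMT.of_taut_imp hb fun v hv h => (hv.bot h).elim)
  · exact hβM (hMT.of_taut_imp₂ h1 h2 fun v hv h h' => ((hv.neg _).1 h h').elim)
  · by_contra h2
    exact hβM (hMT.of_taut_imp₂ (hmax _ h1) (hmax _ h2) fun v hv => by
      simp only [hv.imp, hv.neg]; tauto)
  · exact hMT.of_taut_imp h1 fun v hv h => ((hv.and _ _).1 h).1
  · exact hMT.of_taut_imp h1 fun v hv h => ((hv.and _ _).1 h).2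
  · exact hMT.of_taut_imp₂ h1.1 h1.2 fun v hv h h' => (hv.and _ _).2 ⟨h, h'⟩

end IsTheory

theorem isTheory_S2IC : IsTheory {φ | S2IC φ} := ⟨S2IC.taut, S2IC.modus_ponens⟩

theorem S2IC.of_taut_iff {φ ψ : Formula} (h : ∀ v, IsValuation v → (v φ ↔ v ψ)) :
    S2IC (φ.iff ψ) :=
  S2IC.taut _ fun _ hb hn ha => (IsValuation.iff ⟨hb, hn, ha⟩ _ _).2 (h _ ⟨hb, hn, ha⟩)

/-! ### Strict implication in maximal consistent sets. -/

/-- Maximal consistent sets of the calculus. -/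
structure IsMaximalConsistent (Γ : Formula → Prop) : Prop extends IsValuation Γ where
  thm : ∀ φ, S2IC φ → Γ φ

namespace IsMaximalConsistent

variable {Γ : Formula → Prop} (hΓ : IsMaximalConsistent Γ)
include hΓ

theorem strict_and (α β γ : Formula) :
    Γ (.strict α (.and β γ)) ↔ Γ (.strict α β) ∧ Γ (.strict α γ) := by
  rw [← hΓ.and, ← hΓ.iff]
  exact hΓ.thm _ (.and_right _ _ _)

theorem or_strict (α β γ : Formula) :
    Γ (.strict (.or α β) γ) ↔ Γ (.strict α γ) ∧ Γ (.strict β γ) := by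
  rw [← hΓ.and, ← hΓ.iff]
  exact hΓ.thm _ (.or_left _ _ _)

theorem strict_symm (α β : Formula) :
    Γ (.strict α β) ↔ Γ (.strict (.neg β) (.neg α)) := by
  rw [← hΓ.iff]
  exact hΓ.thm _ (.symmetry _ _)

theorem strict_congr {α α' β β' : Formula} (h : ∀ v, IsValuation v → (v α ↔ v α'))
    (h' : ∀ v, IsValuation v → (v β ↔ v β')) : Γ (.strict α β) ↔ Γ (.strict α' β') := by
  rw [← hΓ.iff]
  exact hΓ.thm _ (.congruence _ _ _ _ (.of_taut_iff h) (.of_taut_iff h'))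

theorem strict_of_taut_left {α α' β : Formula} (h : ∀ v, IsValuation v → v α' → v α)
    (hs : Γ (.strict α β)) : Γ (.strict α' β) := by
  refine ((hΓ.or_strict α α' β).1 ((hΓ.strict_congr (α' := .or α α') (fun v hv => ?_)
    fun v hv => Iff.rfl).1 hs)).2
  have := h v hv
  rw [hv.or]; tauto

theorem strict_of_taut_right {α β β' : Formula} (h : ∀ v, IsValuation v → v β → v β')
    (hs : Γ (.strict α β)) : Γ (.strict α β') := by
  refine ((hΓ.strict_and α β β').1 ((hΓ.strict_congr (β' := .and β β') (fun v hv => Iff.rfl)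
    fun v hv => ?_).1 hs)).2
  have := h v hv
  rw [hv.and]; tauto

theorem strict_of_box {α β : Formula} (h : Γ β.box) : Γ (.strict α β) :=
  hΓ.strict_of_taut_left (fun _ hv _ => hv.top) h

theorem strict_mp {α β γ : Formula} (h : Γ (.strict α (.imp β γ))) (h' : Γ (.strict α β)) :
    Γ (.strict α γ) :=
  hΓ.strict_of_taut_right (fun v hv => by rw [hv.and, hv.imp]; tauto)
    ((hΓ.strict_and α (.imp β γ) β).2 ⟨h, h'⟩)

theorem box_of_thm {φ : Formula} (h : S2IC φ) : Γ φ.box := hΓ.thm _ (.necessitation _ h)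

/-- The formulas strictly implied by `α` form a theory. -/
theorem isTheory_strict (α : Formula) : IsTheory {δ | Γ (.strict α δ)} where
  taut _ h := hΓ.strict_of_box (hΓ.box_of_thm (.taut _ h))
  mp _ _ h h' := hΓ.strict_mp h h'

/-- The symmetry axiom turns a weakening on the left into one on the right, where `strict_mp`
applies. -/
theorem strict_of_box_imp_left {α α' β : Formula} (h : Γ (Formula.imp α' α).box)
    (hs : Γ (.strict α β)) : Γ (.strict α' β) := by
  rw [hΓ.strict_symm] at hs ⊢
  refine hΓ.strict_mp (hΓ.strict_of_box ?_) hs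
  exact hΓ.strict_of_taut_right (fun v hv => by simp only [hv.imp, hv.neg]; tauto) h

theorem of_box {φ : Formula} (h : Γ φ.box) : Γ φ := by
  have := hΓ.thm _ (.strict_imp .top φ)
  rw [hΓ.imp, hΓ.imp] at this
  exact this h hΓ.top

theorem box_strict {α β : Formula} (h : Γ (.strict α β)) : Γ (Formula.strict α β).box := by
  have := hΓ.thm _ (.strict_box α β)
  rw [hΓ.iff] at this
  exact this.1 h

/-- Axiom `five` gives the necessity of `¬□(α ⇝ β)`, and `α ⇝ β` is provably equivalent to its own
box. Together with `box_strict`, every strict implication is necessarily true or necessarily false.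
-/
theorem box_neg_strict {α β : Formula} (h : ¬ Γ (.strict α β)) :
    Γ (Formula.neg (.strict α β)).box := by
  have h1 := hΓ.thm _ (.strict_box α β)
  rw [hΓ.iff] at h1
  have h2 := hΓ.thm _ (.five (.strict α β))
  rw [hΓ.imp, hΓ.neg] at h2
  refine hΓ.strict_mp (hΓ.box_of_thm ?_) (h2 fun h3 => h (h1.2 h3))
  exact isTheory_S2IC.of_taut_imp (S2IC.strict_box α β) fun v hv => by
    simp only [hv.iff, hv.imp, hv.neg]; tauto

/-- A strict implication that fails is witnessed by two related valuations. -/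
theorem exists_witness {α β : Formula} (h : ¬ Γ (.strict α β)) :
    ∃ w v, IsValuation w ∧ IsValuation v ∧ (∀ φ, Γ φ.box → w φ) ∧ (∀ φ, Γ φ.box → v φ) ∧
      (∀ γ δ, Γ (.strict γ δ) → w γ → v δ) ∧ w α ∧ ¬ v β := by
  obtain ⟨v, hv, hαv, hvβ⟩ := (hΓ.isTheory_strict α).exists_valuation (β := β) h
  have hbb : Γ (.strict .bot .bot) :=
    ((hΓ.and _ _).1 (hΓ.thm _ (.bounds .bot))).1
  -- These are the formulas forced on a valuation of `α` in contact with `v`: their failure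
  -- alongside `α` would strictly imply something false at `v`.
  have hth : IsTheory {ε | ∃ δ, ¬ v δ ∧ Γ (.strict (.and α (.neg ε)) δ)} := by
    refine ⟨fun φ hφ => ⟨.bot, hv.bot, hΓ.strict_of_taut_left (fun u hu => ?_) hbb⟩, ?_⟩
    · rw [hu.and, hu.neg]
      exact fun k => (k.2 (hφ u hu.bot hu.neg hu.and)).elim
    · rintro φ ψ ⟨δ, hδ, h1⟩ ⟨δ', hδ', h2⟩
      refine ⟨.or δ δ', by rw [hv.or]; tauto, ?_⟩
      refine hΓ.strict_of_taut_left
        (α := .or (.and α (.neg (.imp φ ψ))) (.and α (.neg φ))) (fun u hu => ?_)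
        ((hΓ.or_strict _ _ _).2 ⟨?_, ?_⟩)
      · simp only [hu.or, hu.and, hu.neg, hu.imp]; tauto
      · exact hΓ.strict_of_taut_right (fun u hu k => (hu.or _ _).2 (.inl k)) h1
      · exact hΓ.strict_of_taut_right (fun u hu k => (hu.or _ _).2 (.inr k)) h2
  have hnb : Formula.bot ∉ {ε | ∃ δ, ¬ v δ ∧ Γ (.strict (.and α (.neg ε)) δ)} := by
    rintro ⟨δ, hδ, h1⟩
    refine hδ (hαv δ (hΓ.strict_of_taut_left (fun u hu k => ?_) h1))
    exact (hu.and _ _).2 ⟨k, hu.top⟩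
  obtain ⟨w, hw, hΔw, -⟩ := hth.exists_valuation hnb
  refine ⟨w, v, hw, hv, fun φ hφ => hΔw φ ⟨.bot, hv.bot, ?_⟩,
    fun φ hφ => hαv φ (hΓ.strict_of_box hφ), fun γ δ hγδ hwγ => ?_,
    hΔw α ⟨.bot, hv.bot, ?_⟩, hvβ⟩
  · refine hΓ.strict_of_box_imp_left (hΓ.strict_of_taut_right (fun u hu k => ?_) hφ) hbb
    simp only [hu.imp, hu.and, hu.neg]; tauto
  · by_contra hδ
    refine (hw.neg γ).1 (hΔw _ ⟨δ, hδ, hΓ.strict_of_taut_left (fun u hu => ?_) hγδ⟩) hwγ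
    simp only [hu.and, hu.neg]; tauto
  · refine hΓ.strict_of_taut_left (fun u hu => ?_) hbb
    simp only [hu.and, hu.neg]; tauto

end IsMaximalConsistent

/-! ### The canonical compact Hausdorff space -/

/-- Triples `(a, b, t)` of two valuations `a`, `b` that extend the necessary formulas of `Γ` and are
in contact, and of a point `t` of the interval `[-1, 1]`. -/
def canonicalSet (Γ : Formula → Prop) :
    Set ((Formula → Bool) × (Formula → Bool) × ULift.{u} (Icc (-1 : ℝ) 1)) :=
  {p | (IsValuation (p.1 · = true) ∧ ∀ φ, Γ φ.box → p.1 φ = true) ∧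
    (IsValuation (p.2.1 · = true) ∧ ∀ φ, Γ φ.box → p.2.1 φ = true) ∧
    ∀ φ ψ, Γ (.strict φ ψ) → p.1 φ = true → p.2.1 ψ = true}

theorem isClosed_setOf_isValuation :
    IsClosed {a : Formula → Bool | IsValuation (a · = true)} := by
  have : {a : Formula → Bool | IsValuation (a · = true)} =
      {a | ¬ a .bot = true} ∩ (⋂ α : Formula, {a | a (.neg α) = true ↔ ¬ a α = true}) ∩
        ⋂ α : Formula, ⋂ β : Formula, {a | a (.and α β) = true ↔ a α = true ∧ a β = true} := by
    ext a
    simp only [mem_inter_iff, mem_iInter, mem_ofPred_eq]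
    exact ⟨fun h => ⟨⟨h.bot, h.neg⟩, h.and⟩, fun h => ⟨h.1.1, h.1.2, h.2⟩⟩
  rw [this]
  refine (IsClosed.inter ?_ (isClosed_iInter fun α => ?_)).inter
    (isClosed_iInter fun α => isClosed_iInter fun β => ?_)
  · exact (isClosed_discrete {x : Bool | ¬ x = true}).preimage
      (f := fun a : Formula → Bool => a .bot) (by fun_prop)
  · exact (isClosed_discrete {x : Bool × Bool | x.1 = true ↔ ¬ x.2 = true}).preimage
      (f := fun a : Formula → Bool => (a (.neg α), a α)) (by fun_prop)
  · exact (isClosed_discrete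
      {x : Bool × Bool × Bool | x.1 = true ↔ x.2.1 = true ∧ x.2.2 = true}).preimage
      (f := fun a : Formula → Bool => (a (.and α β), a α, a β)) (by fun_prop)

theorem isClosed_setOf_extends (T : Formula → Prop) :
    IsClosed {a : Formula → Bool | ∀ φ, T φ → a φ = true} := by
  simp only [ofPred_forall]
  exact isClosed_iInter fun φ => isClosed_iInter fun _ => isClosed_eq (by fun_prop) (by fun_prop)

theorem isClosed_canonicalSet (Γ : Formula → Prop) : IsClosed (canonicalSet.{u} Γ) := by
  have hval := isClosed_setOf_isValuation.inter (isClosed_setOf_extends fun φ => Γ φ.box)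
  refine (hval.preimage continuous_fst).inter
    ((hval.preimage (continuous_fst.comp continuous_snd)).inter ?_)
  change IsClosed {p : (Formula → Bool) × (Formula → Bool) × ULift.{u} (Icc (-1 : ℝ) 1) |
    ∀ φ ψ, Γ (.strict φ ψ) → p.1 φ = true → p.2.1 ψ = true}
  simp only [ofPred_forall]
  refine isClosed_iInter fun φ => isClosed_iInter fun ψ => isClosed_iInter fun _ => ?_
  exact (isClosed_discrete {x : Bool × Bool | x.1 = true → x.2 = true}).preimage
    (f := fun p : (Formula → Bool) × (Formula → Bool) × ULift.{u} (Icc (-1 : ℝ) 1) =>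
      (p.1 φ, p.2.1 ψ)) (by fun_prop)

/-- The canonical compact Hausdorff space of a maximal consistent set. -/
abbrev CanonicalSpace (Γ : Formula → Prop) : Type u := canonicalSet.{u} Γ

instance (Γ : Formula → Prop) : CompactSpace (CanonicalSpace.{u} Γ) :=
  isCompact_iff_compactSpace.1 (isClosed_canonicalSet Γ).isCompact

namespace CanonicalSpace

variable {Γ : Formula → Prop}

/-- The first valuation. -/
def fst (p : CanonicalSpace.{u} Γ) (φ : Formula) : Prop := p.1.1 φ = true

/-- The second valuation. -/
def snd (p : CanonicalSpace.{u} Γ) (φ : Formula) : Prop := p.1.2.1 φ = true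

/-- The coordinate in the interval. -/
def coord (p : CanonicalSpace.{u} Γ) : ℝ := p.1.2.2.down

theorem fst_isValuation (p : CanonicalSpace.{u} Γ) : IsValuation p.fst := p.2.1.1

theorem snd_isValuation (p : CanonicalSpace.{u} Γ) : IsValuation p.snd := p.2.2.1.1

theorem fst_of_box (p : CanonicalSpace.{u} Γ) {φ : Formula} (h : Γ φ.box) : p.fst φ :=
  p.2.1.2 φ h

theorem snd_of_box (p : CanonicalSpace.{u} Γ) {φ : Formula} (h : Γ φ.box) : p.snd φ :=
  p.2.2.1.2 φ h

theorem snd_of_fst (p : CanonicalSpace.{u} Γ) {φ ψ : Formula} (h : Γ (.strict φ ψ))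
    (h' : p.fst φ) : p.snd ψ := p.2.2.2 φ ψ h h'

theorem continuous_coord : Continuous (coord : CanonicalSpace.{u} Γ → ℝ) :=
  continuous_subtype_val.comp (continuous_uliftDown.comp
    (continuous_snd.comp (continuous_snd.comp continuous_subtype_val)))

theorem isClopen_fst (φ : Formula) : IsClopen {p : CanonicalSpace.{u} Γ | p.fst φ} :=
  (isClopen_discrete {true}).preimage (f := fun p : CanonicalSpace.{u} Γ => p.1.1 φ) (by fun_prop)

theorem isClopen_snd (φ : Formula) : IsClopen {p : CanonicalSpace.{u} Γ | p.snd φ} :=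
  (isClopen_discrete {true}).preimage (f := fun p : CanonicalSpace.{u} Γ => p.1.2.1 φ) (by fun_prop)

/-- Replacing the coordinate. -/
def move (p : CanonicalSpace.{u} Γ) (t : Icc (-1 : ℝ) 1) : CanonicalSpace.{u} Γ :=
  ⟨(p.1.1, p.1.2.1, ⟨t⟩), p.2⟩

theorem continuous_move (p : CanonicalSpace.{u} Γ) : Continuous p.move :=
  Continuous.subtype_mk (by fun_prop) _

/-- Together with its mirror image below, this makes `0` a limit of both halves of the segment, at
each of which a single valuation decides. -/
theorem mem_closure_neg {t : Icc (-1 : ℝ) 1} (ht : (t : ℝ) ≤ 0) :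
    t ∈ closure {s : Icc (-1 : ℝ) 1 | (s : ℝ) < 0} := by
  rw [closure_subtype]
  have h : Ico (-1 : ℝ) 0 ⊆ (↑) '' {s : Icc (-1 : ℝ) 1 | (s : ℝ) < 0} :=
    fun s hs => ⟨⟨s, hs.1, by linarith [hs.2]⟩, hs.2, rfl⟩
  refine closure_mono h ?_
  rw [closure_Ico (by norm_num)]
  exact ⟨t.2.1, ht⟩

theorem mem_closure_pos {t : Icc (-1 : ℝ) 1} (ht : 0 ≤ (t : ℝ)) :
    t ∈ closure {s : Icc (-1 : ℝ) 1 | 0 < (s : ℝ)} := by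
  rw [closure_subtype]
  have h : Ioc (0 : ℝ) 1 ⊆ (↑) '' {s : Icc (-1 : ℝ) 1 | 0 < (s : ℝ)} :=
    fun s hs => ⟨⟨s, by linarith [hs.1], hs.2⟩, hs.1, rfl⟩
  refine closure_mono h ?_
  rw [closure_Ioc (by norm_num)]
  exact ⟨ht, t.2.2⟩

/-! ### The interpretation of formulas. -/

/-- The regular open set interpreting `φ`. -/
def truth (Γ : Formula → Prop) (φ : Formula) : Set (CanonicalSpace.{u} Γ) :=
  {p | (p.coord ≤ 0 → p.fst φ) ∧ (0 ≤ p.coord → p.snd φ)}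

theorem isOpen_truth (φ : Formula) : IsOpen (truth.{u} Γ φ) := by
  have : truth.{u} Γ φ =
      ({p | 0 < p.coord} ∪ {p | p.fst φ}) ∩ ({p | p.coord < 0} ∪ {p | p.snd φ}) := by
    ext p
    simp only [truth, mem_ofPred_eq, mem_inter_iff, mem_union, ← not_le]
    tauto
  rw [this]
  exact ((isOpen_lt continuous_const continuous_coord).union (isClopen_fst φ).isOpen).inter
    ((isOpen_lt continuous_coord continuous_const).union (isClopen_snd φ).isOpen)

/-- A point satisfying one of the two clauses is approached by moving only its coordinate, into the
open half where the other valuation plays no role. -/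
theorem closure_truth (φ : Formula) : closure (truth.{u} Γ φ) =
    {p | (p.coord ≤ 0 ∧ p.fst φ) ∨ (0 ≤ p.coord ∧ p.snd φ)} := by
  apply Subset.antisymm
  · refine closure_minimal (fun p hp => ?_) ?_
    · rcases le_total p.coord 0 with h | h
      · exact .inl ⟨h, hp.1 h⟩
      · exact .inr ⟨h, hp.2 h⟩
    · exact ((isClosed_le continuous_coord continuous_const).inter (isClopen_fst φ).isClosed).union
        ((isClosed_le continuous_const continuous_coord).inter (isClopen_snd φ).isClosed)
  · rintro p (⟨ht, hp⟩ | ⟨ht, hp⟩)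
    · refine map_mem_closure (f := p.move) (continuous_move p) (mem_closure_neg ht) fun s hs => ?_
      exact ⟨fun _ => hp, fun h => absurd hs (not_lt.2 h)⟩
    · refine map_mem_closure (f := p.move) (continuous_move p) (mem_closure_pos ht) fun s hs => ?_
      exact ⟨fun h => absurd hs (not_lt.2 h), fun _ => hp⟩

theorem truth_bot : truth.{u} Γ .bot = ∅ := by
  ext p
  simp only [truth, mem_ofPred_eq, mem_empty_iff_false, iff_false]
  rintro ⟨h, h'⟩
  rcases le_total p.coord 0 with k | k
  exacts [p.fst_isValuation.bot (h k), p.snd_isValuation.bot (h' k)]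

theorem truth_neg (φ : Formula) : truth.{u} Γ (.neg φ) = perp (truth Γ φ) := by
  rw [perp, closure_truth]
  ext p
  simp only [truth, mem_ofPred_eq, mem_compl_iff, p.fst_isValuation.neg, p.snd_isValuation.neg]
  tauto

theorem isRegularOpen_truth (φ : Formula) : IsRegularOpen (truth.{u} Γ φ) := by
  rw [IsRegularOpen, ← truth_neg, ← truth_neg]
  ext p
  simp only [truth, mem_ofPred_eq, p.fst_isValuation.neg, p.snd_isValuation.neg, not_not]

theorem truth_and (φ ψ : Formula) : truth.{u} Γ (.and φ ψ) = truth Γ φ ∩ truth Γ ψ := by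
  ext p
  simp only [truth, mem_ofPred_eq, mem_inter_iff, p.fst_isValuation.and, p.snd_isValuation.and]
  tauto

theorem truth_of_box {φ : Formula} (h : Γ φ.box) : truth.{u} Γ φ = univ :=
  eq_univ_of_forall fun p => ⟨fun _ => p.fst_of_box h, fun _ => p.snd_of_box h⟩

theorem truth_of_box_neg {φ : Formula} (h : Γ (Formula.neg φ).box) : truth.{u} Γ φ = ∅ := by
  ext p
  simp only [truth, mem_ofPred_eq, mem_empty_iff_false, iff_false]
  rintro ⟨k, k'⟩
  rcases le_total p.coord 0 with l | l
  exacts [(p.fst_isValuation.neg _).1 (p.fst_of_box h) (k l),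
    (p.snd_isValuation.neg _).1 (p.snd_of_box h) (k' l)]

variable (hΓ : IsMaximalConsistent Γ)
include hΓ

theorem imp_of_strict {φ ψ : Formula} (h : Γ (.strict φ ψ)) : Γ (φ.imp ψ).box :=
  hΓ.strict_mp (hΓ.box_of_thm (.strict_imp φ ψ)) (hΓ.box_strict h)

/-- All the information sits at coordinate `0`, where membership in the closure of `truth Γ φ` needs
one valuation and membership in `truth Γ ψ` needs both. -/
theorem closure_truth_subset_iff (φ ψ : Formula) :
    closure (truth.{u} Γ φ) ⊆ truth Γ ψ ↔ Γ (.strict φ ψ) := by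
  rw [closure_truth]
  constructor
  · intro h
    by_contra hs
    obtain ⟨w, v, hw, hv, hbw, hbv, hR, hφ, hψ⟩ := hΓ.exists_witness hs
    classical
    let p : CanonicalSpace.{u} Γ :=
      ⟨(fun α => decide (w α), fun α => decide (v α), ⟨⟨0, by simp⟩⟩), by
      simpa [canonicalSet] using ⟨⟨hw, hbw⟩, ⟨hv, hbv⟩, hR⟩⟩
    have hp : p ∈ truth Γ ψ := h (.inl ⟨le_refl (0 : ℝ), decide_eq_true hφ⟩)
    exact hψ (of_decide_eq_true (hp.2 (le_refl (0 : ℝ))))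
  · rintro h p (⟨ht, hp⟩ | ⟨ht, hp⟩)
    · exact ⟨fun _ => (p.fst_isValuation.imp _ _).1 (p.fst_of_box (imp_of_strict hΓ h)) hp,
        fun _ => p.snd_of_fst h hp⟩
    · refine ⟨fun _ => ?_, fun _ =>
        (p.snd_isValuation.imp _ _).1 (p.snd_of_box (imp_of_strict hΓ h)) hp⟩
      -- Contact is only imposed from the first valuation to the second; the symmetry axiom supplies
      -- the other direction by contraposition.
      by_contra hψ
      exact (p.snd_isValuation.neg _).1 (p.snd_of_fst ((hΓ.strict_symm _ _).1 h)
        ((p.fst_isValuation.neg _).2 hψ)) hp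

theorem eval_eq (φ : Formula) :
    φ.eval (fun p => ClosedSet.inside (truth.{u} Γ (.letter p))) =
      ClosedSet.inside (truth.{u} Γ φ) := by
  refine ClosedSet.eval_eq_inside isOpen_truth truth_bot truth_neg truth_and
    (fun φ ψ h => ?_) (fun φ ψ h => ?_) φ
  · exact truth_of_box (hΓ.box_strict ((closure_truth_subset_iff hΓ φ ψ).1 h))
  · exact truth_of_box_neg (hΓ.box_neg_strict fun k => h ((closure_truth_subset_iff hΓ φ ψ).2 k))

theorem exists_notMem_truth {φ : Formula} (h : ¬ Γ φ) : ∃ p, p ∉ truth.{u} Γ φ := by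
  have hnot : ¬ Γ (.strict .top φ) := fun k => h (hΓ.of_box k)
  by_contra! hall
  exact hnot ((closure_truth_subset_iff.{u} hΓ _ _).1 fun p _ => hall p)

end CanonicalSpace

/-! ### Completeness. -/

theorem S2IC.complete {φ : Formula}
    (h : ∀ (X : Type u) [TopologicalSpace X], IsDVSpace X → Valid X φ) : S2IC φ := by
  by_contra hφ
  obtain ⟨Γ, hval, hthm, hΓφ⟩ := isTheory_S2IC.exists_valuation (β := φ) hφ
  have hΓ : IsMaximalConsistent Γ := ⟨hval, hthm⟩
  have hX := h (ClosedSet (CanonicalSpace.{u} Γ)) ClosedSet.isDVSpace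
    (fun p => ClosedSet.inside (CanonicalSpace.truth Γ (.letter p)))
    fun p => ClosedSet.isRegularOpen_inside (CanonicalSpace.isRegularOpen_truth _)
  rw [CanonicalSpace.eval_eq hΓ] at hX
  obtain ⟨p, hp⟩ := CanonicalSpace.exists_notMem_truth.{u} hΓ hΓφ
  have : ClosedSet.point p ∈ ClosedSet.inside (CanonicalSpace.truth Γ φ) := hX ▸ mem_univ _
  exact hp (by simpa using this)

end Canonical

end DeVries

/-- A formula is a theorem of `S²IC` iff it is valid on every `dV`-space. -/
theorem theorem7p5 (φ : DeVries.Formula) :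
    DeVries.S2IC φ ↔
      ∀ (X : Type u) [TopologicalSpace X], DeVries.IsDVSpace X → DeVries.Valid X φ :=
  ⟨fun h _ _ hX => h.sound hX.orderRegular, DeVries.S2IC.complete⟩
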